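/- Let $\kappa$ be an inaccessible cardinal (an uncountable regular strong limit cardinal), let $L$ be a relational first-order language with $|L|<\kappa$, and let $\mathrm{Str}(L)$ be the category of all $L$-structures with homomorphisms, i.e. maps $f$ with $\bar m\in R^M\Rightarrow f(\bar m)\in R^N$ for every $R\in L$. Let $\mathfrak C$ be a full subcategory of $\mathrm{Str}(L)$, and let $\mathfrak C_{<\kappa}$ be its full subcategory on the objects of cardinality $<\kappa$. Let $\mathbf{Card}_{<\kappa}$ be the category whose objects are the cardinals $\lambda<\kappa$, viewed as structures $(\lambda,\in)$ (initial ordinals with their order), and whose morphisms are the homomorphisms of these structures, i.e. the maps $f$ with $f(i)<f(j)$ whenever $i<j$. If there is a full embedding (a full and faithful functor) $\Psi:\mathbf{Card}_{<\kappa}\to\mathfrak C_{<\kappa}$, then the class $\mathsf{Gaif}(\mathfrak C)=\{\mathsf{Gaif}(M): M\in\mathrm{obj}(\mathfrak C)\}$ is $\kappa$-somewhere dense. Here the Gaifman graph $\mathsf{Gaif}(M)$ is the undirected graph on the underlying set of $M$ in which two distinct elements are adjacent if and only if they occur together in some tuple of some relation $R^M$, $R\in L$. For $r\in\omega$ and a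 cardinal $\lambda$, $K_\lambda^r$ denotes the graph obtained from the complete undirected graph $K_\lambda$ on $\lambda$ vertices by replacing each edge by a path of length $r+1$. A class $\mathcal G$ of undirected graphs is $\kappa$-nowhere dense if for every $r\in\omega$ there is a cardinal $\lambda<\kappa$ such that $K_\lambda^r$ is not a (not necessarily induced) subgraph of any $G\in\mathcal G$, and it is $\kappa$-somewhere dense if it is not $\kappa$-nowhere dense; that is, there is $r\in\omega$ such that for every cardinal $\lambda<\kappa$ some $G\in\mathcal G$ contains $K_\lambda^r$ as a subgraph. -/

import Mathlib

open CategoryTheory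

universe u

/-! ### The category of structures of a relational language -/

/-- A structure of the first-order language `L`. -/
structure Str (L : FirstOrder.Language.{u, u}) where
  carrier : Type u
  [str : L.Structure carrier]

attribute [instance] Str.str

/-- The category of all `L`-structures with homomorphisms. -/
instance Str.category (L : FirstOrder.Language.{u, u}) : Category.{u} (Str L) where
  Hom M N := FirstOrder.Language.Hom L M.carrier N.carrier
  id M := FirstOrder.Language.Hom.id L M.carrier
  comp f g := FirstOrder.Language.Hom.comp g f

/-- For a full subcategory `C` of the category of `L`-structures, given by its class of objects,
the class of objects of `C` with fewer than `κ` elements. -/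
def Str.below {L : FirstOrder.Language.{u, u}} (C : ObjectProperty (Str L)) (κ : Cardinal.{u}) :
    ObjectProperty (Str L) :=
  fun M => C M ∧ Cardinal.mk M.carrier < κ

/-! ### The category of cardinals -/

/-- The cardinals smaller than `κ`. -/
structure CardBelow (κ : Cardinal.{u}) where
  card : Cardinal.{u}
  lt : card < κ

/-- The cardinal `a` as an initial ordinal, that is, as a type well-ordered in the order type
`a.ord`. The order `<` plays the role of `∈`. -/
abbrev CardBelow.Elem {κ : Cardinal.{u}} (a : CardBelow κ) : Type u := a.card.ord.ToType

/-- The category of cardinals smaller than `κ`. A morphism from `a` to `b` is a homomorphism of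
the structures `(a, ∈)` and `(b, ∈)`, that is, a map `f` with `f i < f j` whenever `i < j`. -/
instance CardBelow.category (κ : Cardinal.{u}) : Category.{u} (CardBelow κ) where
  Hom a b := RelHom (fun i j : a.Elem => i < j) (fun i j : b.Elem => i < j)
  id a := RelHom.id (fun i j : a.Elem => i < j)
  comp f g := RelHom.comp g f

/-! ### Subdivisions and somewhere dense classes of graphs -/

/-- The `k`-th vertex (for `k = 0, …, r + 1`) of the path of length `r + 1` that replaces the edge
`e` of `G` in the `r`-subdivision of `G`. The path starts at one end of `e` (the choice of which is
immaterial), goes through the `r` subdivision points of `e`, and finishes at the other end. -/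
noncomputable def subdivisionPoint {V : Type u} (G : SimpleGraph V) (r : ℕ) (e : G.edgeSet) :
    ℕ → V ⊕ (G.edgeSet × Fin r)
  | 0 => Sum.inl (Quot.out e.1).1
  | k + 1 => if h : k < r then Sum.inr (e, ⟨k, h⟩) else Sum.inl (Quot.out e.1).2

/-- The `r`-subdivision of `G`: every edge of `G` is replaced by a path of length `r + 1`. The
vertices are the native vertices `Sum.inl v` and the subdivision points `Sum.inr (e, k)`. -/
def subdivision {V : Type u} (G : SimpleGraph V) (r : ℕ) :
    SimpleGraph (V ⊕ (G.edgeSet × Fin r)) :=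
  SimpleGraph.fromRel fun x y =>
    ∃ e : G.edgeSet, ∃ k ≤ r, x = subdivisionPoint G r e k ∧ y = subdivisionPoint G r e (k + 1)

/-- The complete graph on `c` vertices. -/
abbrev completeGraphOn (c : Cardinal.{u}) : SimpleGraph c.out := ⊤

/-- A class of undirected graphs. -/
abbrev GraphClass : Type (u + 1) := Set (Σ V : Type u, SimpleGraph V)

/-- `𝒞` is `κ`-nowhere dense: for every `r` there is a cardinal `c < κ` such that the
`r`-subdivision of the complete graph on `c` vertices is not a subgraph of any `G ∈ 𝒞`. -/
def NowhereDense (𝒞 : GraphClass.{u}) (κ : Cardinal.{u}) : Prop :=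
  ∀ r : ℕ, ∃ c : Cardinal.{u}, c < κ ∧
    ∀ G ∈ 𝒞, ¬ (subdivision (completeGraphOn c) r).IsContained G.2

/-- `𝒞` is `κ`-somewhere dense if it is not `κ`-nowhere dense. -/
def SomewhereDense (𝒞 : GraphClass.{u}) (κ : Cardinal.{u}) : Prop :=
  ¬ NowhereDense 𝒞 κ

/-! ### Gaifman graphs -/

/-- The Gaifman graph of a structure: two distinct elements are adjacent if they appear together
in a tuple that belongs to some relation. -/
def gaifmanGraph {L : FirstOrder.Language.{u, u}} (M : Str L) : SimpleGraph M.carrier where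
  Adj x y := x ≠ y ∧ ∃ (n : ℕ) (R : L.Relations n) (v : Fin n → M.carrier),
    FirstOrder.Language.Structure.RelMap R v ∧ x ∈ Set.range v ∧ y ∈ Set.range v
  symm := ⟨fun _ _ ⟨hne, n, R, v, hv, hx, hy⟩ => ⟨hne.symm, n, R, v, hv, hy, hx⟩⟩
  loopless := ⟨fun _ h => h.1 rfl⟩

/-- The class of the Gaifman graphs of the objects of `C`. -/
def gaifmanClass {L : FirstOrder.Language.{u, u}} (C : ObjectProperty (Str L)) :
    GraphClass.{u} :=
  {G | ∃ M : Str L, C M ∧ G = ⟨M.carrier, gaifmanGraph M⟩}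

/-!
Write `M a` for the structure that the full embedding assigns to the cardinal `a`. For a large
regular cardinal `c`, an increasing pair `i < j` of elements of `c` is a morphism from `2` to `c`
and so gives a homomorphism `F i j : M 2 → M c`. Likewise each `i` in `c` gives a map
`f i : M 1 → M c`.

*Homogeneity.* A strictly increasing self-map of `c` acts on `M c`, so it preserves equalities
`F i j u = F k l v`. There are fewer than `c` such equalities up to the order pattern of the
indices, and `c` is regular. Hence, on a sufficiently sparse set of indices, their truth depends
only on `u`, `v` and the order pattern (`exists_isHomogeneous_comp`). In particular, faithfulness
gives a single `x` in `M 1` at which all the maps `f i` differ.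

*Connection.* Let `p` and `p'` be the two images of `x` in `M 2`, and let `i < j < k < l`. If `p`
and `p'` were not connected in the Gaifman graph of `M 2` by a path that avoids the set where
`F i j` and `F k l` agree, then `F k l` on the part reachable from `p` and `F i j` elsewhere would
make up a homomorphism `M 2 → M c` (`exists_glued_hom`). It would send `p` to `f k x` and `p'` to `f j x`
with `j < k`, whereas by fullness it comes from an increasing pair. So there is such a path,
and by homogeneity the images of its vertices differ between `F i j` and `F k l` for all
`i < j < k < l` in the sparse set.

*Subdivisions.* The images of this one path under the maps `F i j` are walks in the Gaifman graph of
`M c` from a vertex that depends on `i` only to a vertex that depends on `j` only. For a shortest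
choice of the path (`IsPathOfMaps.exists_reduced`), homogeneity implies that walks of different
pairs meet only where they must. Joining two such walks with a common right end
gives the edges of a subdivided complete graph (`IsReducedPathOfMaps.subdivision_isContained`).

The number of subdivision points depends on `c`, but the supremum of countably many cardinals
below `κ` is below `κ`, so that one `r` is good for all cardinals below `κ`.
-/

/-! ### Extending order-preserving maps between ordinals -/

namespace Ordinal

/-- A function on ordinals whose values are at least `δ` and more than `δ` apart, and under which
the infinite initial ordinal `c.ord` is closed. -/
theorem exists_gaps {c : Cardinal.{u}} (hc : Cardinal.aleph0 ≤ c) {δ : Ordinal.{u}}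
    (hδ : δ < c.ord) :
    ∃ g : Ordinal.{u} → Ordinal.{u}, (∀ i < c.ord, g i < c.ord) ∧ (∀ i, δ ≤ g i) ∧
      ∀ i j, i < j → g i + δ < g j := by
  have hlim : Order.IsSuccLimit c.ord := Cardinal.isSuccLimit_ord hc
  refine ⟨fun i => (δ + 1) * (i + 1), fun i hi => ?_, fun i => ?_, fun i j hij => ?_⟩
  · have h1 := Cardinal.lt_ord.1 (hlim.succ_lt hδ)
    have h2 := Cardinal.lt_ord.1 (hlim.succ_lt hi)
    rw [Order.succ_eq_add_one] at h1 h2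
    rw [Cardinal.lt_ord, card_mul]
    exact Cardinal.mul_lt_of_lt hc h1 h2
  · calc δ ≤ δ + 1 := le_self_add
      _ = (δ + 1) * 1 := (mul_one _).symm
      _ ≤ (δ + 1) * (i + 1) := by gcongr; simp
  · calc (δ + 1) * (i + 1) + δ < (δ + 1) * (i + 1) + (δ + 1) := by
          gcongr; exact lt_add_one δ
      _ = (δ + 1) * (i + 1 + 1) := by rw [mul_add (δ + 1) (i + 1) 1, mul_one]
      _ ≤ (δ + 1) * (j + 1) := by gcongr; exact Order.add_one_le_of_lt hij

/-- A finite partial function `w a ↦ τ a` between ordinals that respects the order extends to a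
strictly increasing function, provided that its arguments are at most `δ` and its values are at least
`δ` and at least `δ` apart. The arguments `w a` need be neither distinct nor listed in increasing
order. -/
theorem exists_strictMono_extension {ι : Type*} [Finite ι] {δ : Ordinal.{u}} (w τ : ι → Ordinal.{u})
    (hw : ∀ a, w a ≤ δ) (hδ : ∀ a, δ ≤ τ a) (hlt : ∀ a b, w a < w b → τ a + δ ≤ τ b)
    (heq : ∀ a b, w a = w b → τ a = τ b) :
    ∃ σ : Ordinal.{u} → Ordinal.{u}, StrictMono σ ∧ (∀ a, σ (w a) = τ a) ∧
      ∀ c : Cardinal.{u}, Cardinal.aleph0 ≤ c → (∀ a, τ a < c.ord) → ∀ i < c.ord, σ i < c.ord := by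
  cases nonempty_fintype ι
  -- `i ↦ τ a + (i - w a)` is strictly increasing from `w a` on; the extension is the maximum of the
  -- identity and of those of these maps that have started.
  let p : Ordinal.{u} → ι → Ordinal.{u} := fun i a => if w a ≤ i then τ a + (i - w a) else 0
  refine ⟨fun i => max i (Finset.univ.sup (p i)), fun i j hij => ?_, fun a => ?_,
    fun c hc hτ i hi => ?_⟩
  · have hpos : (⊥ : Ordinal.{u}) < max j (Finset.univ.sup (p j)) :=
      lt_of_lt_of_le (lt_of_le_of_lt bot_le hij) (le_max_left _ _)
    refine max_lt (lt_of_lt_of_le hij (le_max_left _ _)) ((Finset.sup_lt_iff hpos).2 fun a _ => ?_)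
    by_cases ha : w a ≤ i
    · refine lt_of_lt_of_le ?_ ((Finset.le_sup (f := p j) (Finset.mem_univ a)).trans
        (le_max_right _ _))
      simp only [p, ha, ha.trans hij.le, if_true]
      gcongr
      rw [Ordinal.lt_sub, Ordinal.add_sub_cancel_of_le ha]
      exact hij
    · simp only [p, ha, if_false]
      exact hpos
  · apply le_antisymm
    · refine max_le ((hw a).trans (hδ a)) (Finset.sup_le fun b _ => ?_)
      simp only [p]
      split_ifs with hb
      · rcases hb.lt_or_eq with hb | hb
        · refine le_trans ?_ (hlt b a hb)
          gcongr
          exact (Ordinal.sub_le_self _ _).trans (hw a)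
        · rw [hb, Ordinal.sub_self, add_zero, heq b a hb]
      · exact bot_le
    · refine le_trans ?_ ((Finset.le_sup (f := p (w a)) (Finset.mem_univ a)).trans
        (le_max_right _ _))
      simp [p]
  · refine max_lt hi ((Finset.sup_lt_iff (lt_of_le_of_lt bot_le hi)).2 fun a _ => ?_)
    simp only [p]
    split_ifs with ha
    · refine Ordinal.isPrincipal_add_ord hc (hτ a) ?_
      exact (Ordinal.sub_le_self _ _).trans_lt hi
    · exact lt_of_le_of_lt bot_le hi

end Ordinal

/-- Inside an infinite initial ordinal there is a copy `s` of it so sparse that a finite tuple `w`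
bounded by `δ` can be moved, by a strictly increasing self-map, to the tuple `s ∘ τ` for every `τ`
of the same order pattern as `w`. -/
theorem exists_sparse {ι : Type*} [Finite ι] {c : Cardinal.{u}} (hc : Cardinal.aleph0 ≤ c)
    (δ : c.ord.ToType) :
    ∃ s : c.ord.ToType → c.ord.ToType, StrictMono s ∧ ∀ w τ : ι → c.ord.ToType,
      (∀ a, w a ≤ δ) → (∀ a b, w a < w b ↔ τ a < τ b) →
      ∃ σ : c.ord.ToType → c.ord.ToType, StrictMono σ ∧ ∀ a, σ (w a) = s (τ a) := by
  let e : Set.Iio c.ord ≃o c.ord.ToType := Ordinal.ToType.mk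
  obtain ⟨g, hg, hδ, hgap⟩ := Ordinal.exists_gaps hc (Set.mem_Iio.1 (e.symm δ).2)
  have hs : ∀ i : c.ord.ToType, g (e.symm i).1 < c.ord := fun i => hg _ (e.symm i).2
  refine ⟨fun i => e ⟨g (e.symm i).1, hs i⟩, fun i j hij => ?_, fun w τ hw hwτ => ?_⟩
  · exact e.lt_iff_lt.2 (show g (e.symm i).1 < g (e.symm j).1 from lt_of_le_of_lt le_self_add
      (hgap (e.symm i).1 (e.symm j).1 (e.symm.lt_iff_lt.2 hij)))
  · obtain ⟨σ, hσ, hσw, hσc⟩ := Ordinal.exists_strictMono_extension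
      (δ := (e.symm δ).1) (fun a => (e.symm (w a)).1) (fun a => g (e.symm (τ a)).1)
      (fun a => by simpa using hw a) (fun a => hδ _)
      (fun a b h => (hgap _ _ (by simpa using (hwτ a b).1 (by simpa using h))).le)
      (fun a b h => by
        have h' : w a = w b := e.symm.injective (Subtype.ext h)
        have h1 : ¬ τ a < τ b := fun h => ((hwτ a b).2 h).ne h'
        have h2 : ¬ τ b < τ a := fun h => ((hwτ b a).2 h).ne h'.symm
        rw [le_antisymm (not_lt.1 h2) (not_lt.1 h1)])
    refine ⟨fun i => e ⟨σ (e.symm i).1, hσc c hc (fun a => hs _) _ (e.symm i).2⟩,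
      fun i j hij => ?_, fun a => ?_⟩
    · exact e.lt_iff_lt.2 (hσ (e.symm.lt_iff_lt.2 hij))
    · simp only [hσw]

theorem exists_bound {c : Cardinal.{u}} (hc : c.IsRegular) {A : Type u}
    (hA : Cardinal.mk A < c) (g : A → c.ord.ToType) : ∃ δ, ∀ a, g a < δ := by
  let e : Set.Iio c.ord ≃o c.ord.ToType := Ordinal.ToType.mk
  have hlim : Order.IsSuccLimit c.ord := Cardinal.isSuccLimit_ord hc.aleph0_le
  have h : (⨆ a, Order.succ (e.symm (g a)).1) < c.ord :=
    Ordinal.iSup_lt_of_lt_cof (by simpa [hc.cof_ord] using hA)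
      fun a => hlim.succ_lt (e.symm (g a)).2
  refine ⟨e ⟨_, h⟩, fun a => ?_⟩
  rw [← e.apply_symm_apply (g a)]
  refine e.lt_iff_lt.2 (show (e.symm (g a)).1 < _ from ?_)
  exact lt_of_lt_of_le (Order.lt_succ _)
    (le_ciSup (f := fun a => Order.succ (e.symm (g a)).1) Ordinal.bddAbove_of_small a)

/-! ### Homogeneous families of functions on increasing pairs -/

section Homogeneous

variable {J : Type*} [LinearOrder J] {U V : Type*}

/-- A family of functions `F u` of increasing pairs is homogeneous if the truth of
`F u i j = F v k l` depends only on `u`, `v` and the order pattern of `i, j, k, l`. Values `F u i j`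
with `j ≤ i` are irrelevant. -/
def IsHomogeneous (F : U → J → J → V) : Prop :=
  ∀ (u v : U) (w τ : Fin 4 → J), (∀ a b, w a < w b ↔ τ a < τ b) → w 0 < w 1 → w 2 < w 3 →
    F u (w 0) (w 1) = F v (w 2) (w 3) → F u (τ 0) (τ 1) = F v (τ 2) (τ 3)

/-- On increasing pairs, `φ` is a function of the first entry. -/
def DependsOnLeft (φ : J → J → V) : Prop :=
  ∀ i j k, i < j → i < k → φ i j = φ i k

/-- On increasing pairs, `φ` is a function of the second entry. -/
def DependsOnRight (φ : J → J → V) : Prop :=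
  ∀ i j k, i < k → j < k → φ i k = φ j k

/-- The maps `θ` and `θ'` replace every point `i` by two points `θ i < θ' i`, leaving the
order between different points as it was. -/
def IsDoubling (θ θ' : J → J) : Prop :=
  (∀ i, θ i < θ' i) ∧ ∀ i j, i < j → θ' i < θ j

theorem IsDoubling.lt_iff {θ θ' : J → J} (h : IsDoubling θ θ') {x y : J} : θ x < θ y ↔ x < y :=
  StrictMono.lt_iff_lt (f := θ) fun x y hxy => (h.1 x).trans (h.2 x y hxy)

theorem IsDoubling.lt_right_iff {θ θ' : J → J} (h : IsDoubling θ θ') {x y : J} (hxy : x ≠ y) :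
    θ x < θ' y ↔ x < y := by
  refine ⟨fun hlt => ?_, fun hlt => (h.lt_iff.2 hlt).trans (h.1 y)⟩
  by_contra hn
  exact lt_asymm hlt (h.2 y x (lt_of_le_of_ne (not_lt.1 hn) hxy.symm))

theorem IsDoubling.right_lt_iff {θ θ' : J → J} (h : IsDoubling θ θ') {x y : J} :
    θ' y < θ x ↔ y < x :=
  ⟨fun hlt => h.lt_iff.1 ((h.1 y).trans hlt), h.2 y x⟩

variable {F : U → J → J → V}

theorem IsHomogeneous.eq (hF : IsHomogeneous F) {u v : U} {i j i' j' : J} (hij : i < j)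
    (hij' : i' < j') (h : F u i j = F v i j) : F u i' j' = F v i' j' := by
  refine hF u v ![i, j, i, j] ![i', j', i', j'] ?_ hij hij h
  intro a b
  fin_cases a <;> fin_cases b <;> simp [hij, hij', hij.not_gt, hij'.not_gt]

/-- If `F u i j = F v k l` and `j` is not one of `k` and `l`, then `j` can be moved without changing
the order pattern, so that `F u` does not depend on its second argument. -/
theorem IsHomogeneous.dependsOnLeft (hF : IsHomogeneous F) {θ θ' : J → J} (h : IsDoubling θ θ')
    {u v : U} {i j k l : J} (hij : i < j) (hkl : k < l)
    (hjk : j ≠ k) (hjl : j ≠ l) (huv : F u i j = F v k l) : DependsOnLeft (F u) := by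
  have e1 : F u (θ i) (θ j) = F v (θ k) (θ l) := by
    refine hF u v ![i, j, k, l] ![θ i, θ j, θ k, θ l] ?_ hij hkl huv
    intro a b
    fin_cases a <;> fin_cases b <;> simp [h.lt_iff]
  have e2 : F u (θ i) (θ' j) = F v (θ k) (θ l) := by
    refine hF u v ![i, j, k, l] ![θ i, θ' j, θ k, θ l] ?_ hij hkl huv
    intro a b
    fin_cases a <;> fin_cases b <;>
      simp [h.lt_iff, h.lt_right_iff hij.ne, h.lt_right_iff hjk.symm,
        h.lt_right_iff hjl.symm, h.right_lt_iff]
  have e3 : ∀ x y z, x < y → y < z → F u x y = F u x z := fun x y z hxy hyz => by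
    have hi := h.lt_iff.2 hij
    refine hF u u ![θ i, θ j, θ i, θ' j] ![x, y, x, z] ?_ hi (hi.trans (h.1 j)) (e1.trans e2.symm)
    intro a b
    fin_cases a <;> fin_cases b <;>
      simp [hi, hi.not_gt, h.1 j, (h.1 j).not_gt, hi.trans (h.1 j), (hi.trans (h.1 j)).not_gt, hxy,
        hxy.not_gt, hyz, hyz.not_gt, hxy.trans hyz, (hxy.trans hyz).not_gt]
  intro x y z hxy hxz
  rcases lt_trichotomy y z with h | rfl | h
  · exact e3 x y z hxy h
  · rfl
  · exact (e3 x z y hxz h).symm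

/-- If `F u i j = F v k l` and `i` is not one of `k` and `l`, then `i` can be moved without changing
the order pattern, so that `F u` does not depend on its first argument. -/
theorem IsHomogeneous.dependsOnRight (hF : IsHomogeneous F) {θ θ' : J → J} (h : IsDoubling θ θ')
    {u v : U} {i j k l : J} (hij : i < j) (hkl : k < l)
    (hik : i ≠ k) (hil : i ≠ l) (huv : F u i j = F v k l) : DependsOnRight (F u) := by
  have e1 : F u (θ i) (θ j) = F v (θ k) (θ l) := by
    refine hF u v ![i, j, k, l] ![θ i, θ j, θ k, θ l] ?_ hij hkl huv
    intro a b
    fin_cases a <;> fin_cases b <;> simp [h.lt_iff]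
  have e2 : F u (θ' i) (θ j) = F v (θ k) (θ l) := by
    refine hF u v ![i, j, k, l] ![θ' i, θ j, θ k, θ l] ?_ hij hkl huv
    intro a b
    fin_cases a <;> fin_cases b <;>
      simp [h.lt_iff, h.lt_right_iff hij.ne', h.lt_right_iff hik.symm,
        h.lt_right_iff hil.symm, h.right_lt_iff]
  have e3 : ∀ x y z, x < y → y < z → F u x z = F u y z := fun x y z hxy hyz => by
    have hi := h.2 i j hij
    have hi' := h.1 i
    refine hF u u ![θ i, θ j, θ' i, θ j] ![x, z, y, z] ?_ (hi'.trans hi) hi (e1.trans e2.symm)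
    intro a b
    fin_cases a <;> fin_cases b <;>
      simp [hi, hi.not_gt, hi', hi'.not_gt, hi'.trans hi, (hi'.trans hi).not_gt, hxy, hxy.not_gt,
        hyz, hyz.not_gt, hxy.trans hyz, (hxy.trans hyz).not_gt]
  intro x y z hxz hyz
  rcases lt_trichotomy x y with h | rfl | h
  · exact e3 x y z h hyz
  · rfl
  · exact (e3 y x z h hxz).symm

/-- A sequence `F (q 0), …, F (q n)` of functions of increasing pairs that leads, uniformly in the
pair `i < j`, along edges of `G` from a vertex determined by `i` to a vertex determined by `j`, and
in which no function is determined by each of the two entries separately. -/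
structure IsPathOfMaps (G : SimpleGraph V) (F : U → J → J → V) (n : ℕ) (q : ℕ → U) : Prop where
  left : DependsOnLeft (F (q 0))
  right : DependsOnRight (F (q n))
  not_both : ∀ t ≤ n, ¬ (DependsOnLeft (F (q t)) ∧ DependsOnRight (F (q t)))
  adj : ∀ t < n, ∀ i j, i < j → G.Adj (F (q t) i j) (F (q (t + 1)) i j)

/-- A path of maps without shortcuts: only the first function depends on the left entry alone, only
the last one on the right entry alone, and no vertex of a path is repeated. -/
structure IsReducedPathOfMaps (G : SimpleGraph V) (F : U → J → J → V) (n : ℕ) (q : ℕ → U) : Prop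
    extends IsPathOfMaps G F n q where
  not_left : ∀ t, 0 < t → t ≤ n → ¬ DependsOnLeft (F (q t))
  not_right : ∀ t < n, ¬ DependsOnRight (F (q t))
  ne : ∀ s t, s < t → t ≤ n → ∀ i j, i < j → F (q s) i j ≠ F (q t) i j

theorem DependsOnRight.congr {φ ψ : J → J → V} (h : ∀ i j, i < j → φ i j = ψ i j)
    (hφ : DependsOnRight φ) : DependsOnRight ψ := fun i j k hik hjk => by
  rw [← h _ _ hik, ← h _ _ hjk, hφ i j k hik hjk]

/-- A path of maps of the least possible length is reduced. -/
theorem IsPathOfMaps.exists_reduced (hF : IsHomogeneous F) {G : SimpleGraph V} {n : ℕ} {q : ℕ → U}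
    (hq : IsPathOfMaps G F n q) : ∃ n q, IsReducedPathOfMaps G F n q := by
  classical
  have hex : ∃ n, ∃ q, IsPathOfMaps G F n q := ⟨n, q, hq⟩
  clear hq n q
  obtain ⟨q, hq⟩ := Nat.find_spec hex
  have hmin : ∀ m q, IsPathOfMaps G F m q → Nat.find hex ≤ m :=
    fun m q h => Nat.find_min' hex ⟨q, h⟩
  generalize Nat.find hex = n at hq hmin
  -- A violation of one of the three conditions gives, in this order, a shorter path: a final part
  -- of `q`, an initial part of `q`, or `q` with the part from `s` to `t` cut out.
  refine ⟨n, q, hq, fun t h0 ht hl => ?_, fun t ht hr => ?_, fun s t hst ht i j hij h => ?_⟩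
  · have := hmin (n - t) (fun s => q (t + s)) ⟨hl, by simpa [ht] using hq.right,
      fun s hs => hq.not_both _ (by omega), fun s hs i j hij => hq.adj (t + s) (by omega) i j hij⟩
    omega
  · have := hmin t q ⟨hq.left, hr, fun s hs => hq.not_both _ (by omega),
      fun s hs i j hij => hq.adj s (by omega) i j hij⟩
    omega
  · have heq : ∀ i j, i < j → F (q s) i j = F (q t) i j := fun _ _ h' => hF.eq hij h' h
    have := hmin (n - (t - s)) (fun k => if k ≤ s then q k else q (k + (t - s))) ⟨?_, ?_, ?_, ?_⟩
    · omega
    · simpa using hq.left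
    · by_cases hk : n - (t - s) ≤ s
      · have h1 : t = n := by omega
        have h2 : n - (t - s) = s := by omega
        subst h1
        simp only [h2, le_refl, if_true]
        exact hq.right.congr fun i j hij => (heq i j hij).symm
      · simp only [hk, if_false]
        rw [show n - (t - s) + (t - s) = n by omega]
        exact hq.right
    · intro k hk
      split_ifs
      · exact hq.not_both k (by omega)
      · exact hq.not_both _ (by omega)
    · intro k hk i j hij
      rcases lt_trichotomy k s with h | rfl | h
      · rw [if_pos h.le, if_pos (by omega)]
        exact hq.adj k (by omega) i j hij
      · rw [if_pos le_rfl, if_neg (by omega), heq i j hij]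
        have := hq.adj t (by omega) i j hij
        rwa [show k + 1 + (t - k) = t + 1 by omega]
      · rw [if_neg (by omega), if_neg (by omega)]
        have := hq.adj (k + (t - s)) (by omega) i j hij
        rwa [show k + 1 + (t - s) = k + (t - s) + 1 by omega]

end Homogeneous

/-! ### Subdivided graphs from reduced paths of maps -/

/-- A reduced path of maps of length `n` yields subdivisions in which every edge is replaced by a
path of length `2 * n`. The vertex `x` becomes the left end at `α x`. The edge `e = xy` becomes the
walk from `x` to the right end at `κ e` along the pair `(α x, κ e)`, followed by the walk back to
`y` along `(α y, κ e)`. Homogeneity makes all the vertices distinct. -/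
theorem IsReducedPathOfMaps.subdivision_isContained {J : Type*} [LinearOrder J] {U : Type*}
    {V W : Type u} {F : U → J → J → V} (hF : IsHomogeneous F) {θ θ' : J → J}
    (hθ : IsDoubling θ θ') {G : SimpleGraph V} {n : ℕ}
    {q : ℕ → U} (hq : IsReducedPathOfMaps G F n q) {H : SimpleGraph W} {α : W → J} {β : J}
    {κ : H.edgeSet → J} (hα : α.Injective) (hκ : κ.Injective) (hαβ : ∀ x, α x < β)
    (hβκ : ∀ e, β < κ e) : (subdivision H (2 * n - 1)).IsContained G := by
  have hn : 0 < n := Nat.pos_of_ne_zero fun h => by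
    subst h
    exact hq.not_both 0 le_rfl ⟨hq.left, hq.right⟩
  have hακ : ∀ x e, α x < κ e := fun x e => (hαβ x).trans (hβκ e)
  -- Away from the left end the second entry of a pair can be read off from the value, and away
  -- from the right end the first entry can.
  have hL : ∀ t, 0 < t → t ≤ n → ∀ {v i j k l}, i < j → k < l → F (q t) i j = F v k l →
      j = k ∨ j = l := fun t h0 ht v i j k l hij hkl h => by
    by_contra! hne
    exact hq.not_left t h0 ht (hF.dependsOnLeft hθ hij hkl hne.1 hne.2 h)
  have hR : ∀ t < n, ∀ {v i j k l}, i < j → k < l → F (q t) i j = F v k l →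
      i = k ∨ i = l := fun t ht v i j k l hij hkl h => by
    by_contra! hne
    exact hq.not_right t ht (hF.dependsOnRight hθ hij hkl hne.1 hne.2 h)
  have hne : ∀ s ≤ n, ∀ t ≤ n, ∀ {i j}, i < j → F (q s) i j = F (q t) i j → s = t :=
    fun s hs t ht i j hij h => by
      rcases lt_trichotomy s t with h' | h' | h'
      · exact absurd h (hq.ne s t h' ht i j hij)
      · exact h'
      · exact absurd h.symm (hq.ne t s h' hs i j hij)
  -- `P e s` is the vertex number `s` of the path that replaces `e`, for `s = 0, …, 2 * n`; `E e s`
  -- is the end of `e` to which this vertex belongs.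
  let E : H.edgeSet → ℕ → W := fun e s => if s ≤ n then (Quot.out e.1).1 else (Quot.out e.1).2
  have hE : ∀ e : H.edgeSet, (Quot.out e.1).1 ≠ (Quot.out e.1).2 := fun e => by
    have h : H.Adj (Quot.out e.1).1 (Quot.out e.1).2 := by
      rw [← SimpleGraph.mem_edgeSet]
      have : s((Quot.out e.1).1, (Quot.out e.1).2) = e.1 := Quot.out_eq e.1
      rw [this]
      exact e.2
    exact h.ne
  let P : H.edgeSet → ℕ → V := fun e s => F (q (min s (2 * n - s))) (α (E e s)) (κ e)
  have hPadj : ∀ e, ∀ s < 2 * n, G.Adj (P e s) (P e (s + 1)) := fun e s hs => by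
    rcases lt_or_ge s n with h | h
    · have := hq.adj s h _ _ (hακ (Quot.out e.1).1 e)
      simpa only [P, E, if_pos h.le, if_pos (show s + 1 ≤ n from h),
        show min s (2 * n - s) = s by omega, show min (s + 1) (2 * n - (s + 1)) = s + 1 by omega]
        using this
    · have := (hq.adj (2 * n - (s + 1)) (by omega) _ _ (hακ (Quot.out e.1).2 e)).symm
      rw [show 2 * n - (s + 1) + 1 = 2 * n - s by omega] at this
      have hs2 : P e (s + 1) = F (q (2 * n - (s + 1))) (α (Quot.out e.1).2) (κ e) := by
        simp only [P, E, if_neg (show ¬ s + 1 ≤ n by omega),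
          show min (s + 1) (2 * n - (s + 1)) = 2 * n - (s + 1) by omega]
      have hs1 : P e s = F (q (2 * n - s)) (α (Quot.out e.1).2) (κ e) := by
        rcases h.eq_or_lt with rfl | h
        · simp only [P, E, if_pos le_rfl, show 2 * n - n = n by omega, min_self]
          exact hq.right _ _ _ (hακ _ e) (hακ _ e)
        · simp only [P, E, if_neg (show ¬ s ≤ n by omega),
            show min s (2 * n - s) = 2 * n - s by omega]
      rw [hs1, hs2]
      exact this
  have hPinj : ∀ e e' s s', 0 < s → s < 2 * n → 0 < s' → s' < 2 * n → P e s = P e' s' →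
      e = e' ∧ s = s' := fun e e' s s' h0 hs h0' hs' h => by
    have hκe : κ e = κ e' := by
      rcases hL _ (by omega) (by omega) (hακ _ e) (hακ _ e') h with h' | h'
      · have h3 := hL _ (by omega) (by omega) (hακ _ e') (hακ _ e) h.symm
        rcases h3 with h3 | h3
        · exact absurd (h'.trans_lt (hακ _ e')) (not_lt.2 (h3.trans_lt (hακ _ e)).le)
        · exact h3.symm
      · exact h'
    obtain rfl := hκ hκe
    refine ⟨rfl, ?_⟩
    have hαe : min s (2 * n - s) < n ∨ min s' (2 * n - s') < n → α (E e s) = α (E e s') := by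
      rintro (h' | h')
      · exact (hR _ h' (hακ _ e) (hακ _ e) h).resolve_right (hακ _ e).ne
      · exact ((hR _ h' (hακ _ e) (hακ _ e) h.symm).resolve_right (hακ _ e).ne).symm
    by_cases hlt : min s (2 * n - s) < n ∨ min s' (2 * n - s') < n
    · have h3 := hαe hlt
      have h4 := hne _ (by omega) _ (by omega) (hακ _ e)
        (show F (q (min s (2 * n - s))) (α (E e s)) (κ e) =
          F (q (min s' (2 * n - s'))) (α (E e s)) (κ e) from h.trans (by simp only [P, h3]))
      have h5 := hα h3
      simp only [E] at h5
      split_ifs at h5 with h6 h7 h7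
      · omega
      · exact absurd h5 (hE e)
      · exact absurd h5.symm (hE e)
      · omega
    · omega
  let Φ : W ⊕ (H.edgeSet × Fin (2 * n - 1)) → V :=
    Sum.elim (fun x => F (q 0) (α x) β) fun y => P y.1 (y.2 + 1)
  have hΦ : ∀ e, ∀ k ≤ 2 * n, Φ (subdivisionPoint H (2 * n - 1) e k) = P e k := by
    rintro e (_ | k) hk
    · simp only [subdivisionPoint, Φ, Sum.elim_inl, P, E, Nat.zero_min, Nat.zero_le, if_true]
      exact hq.left _ _ _ (hαβ _) (hακ _ e)
    · by_cases h : k < 2 * n - 1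
      · simp only [subdivisionPoint, h, dif_pos, Φ, Sum.elim_inr]
      · have hk' : k + 1 = 2 * n := by omega
        simp only [subdivisionPoint, h, dif_neg, not_false_eq_true, Φ, Sum.elim_inl, hk', P, E,
          Nat.sub_self, Nat.min_zero, if_neg (show ¬ 2 * n ≤ n by omega)]
        exact hq.left _ _ _ (hαβ _) (hακ _ e)
  have hΦP : ∀ x e s, 0 < s → s < 2 * n → F (q 0) (α x) β ≠ P e s := fun x e s h0 hs h => by
    rcases hL _ (by omega) (by omega) (hακ _ e) (hαβ x) h.symm with h' | h'
    · exact (hακ x e).ne' h'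
    · exact (hβκ e).ne' h'
  refine ⟨⟨⟨Φ, ?_⟩, ?_⟩⟩
  · intro x y hxy
    rw [subdivision, SimpleGraph.fromRel_adj] at hxy
    obtain ⟨-, ⟨e, k, hk, rfl, rfl⟩ | ⟨e, k, hk, rfl, rfl⟩⟩ := hxy
    · rw [hΦ e k (by omega), hΦ e (k + 1) (by omega)]
      exact hPadj e k (by omega)
    · rw [hΦ e k (by omega), hΦ e (k + 1) (by omega)]
      exact (hPadj e k (by omega)).symm
  · rintro (x | ⟨e, k⟩) (y | ⟨e', k'⟩) h
    · have h' : F (q 0) (α x) β = F (q 0) (α y) β := h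
      exact congrArg _ (hα ((hR 0 hn (hαβ x) (hαβ y) h').resolve_right (hαβ x).ne))
    · exact absurd h (hΦP x e' _ (by omega) (by omega))
    · exact absurd h.symm (hΦP y e _ (by omega) (by omega))
    · obtain ⟨rfl, h'⟩ := hPinj e e' (k + 1) (k' + 1) (by omega) (by omega) (by omega) (by omega) h
      obtain rfl : k = k' := Fin.ext (by omega)
      rfl

/-! ### Homogeneity on a sparse set of indices -/

/-- If equalities between values of `F` are preserved by all strictly increasing maps, then `F` is
homogeneous on a sparse set of indices `s`, where moreover every equality holds that holds for some
indices of the same order pattern. Up to the order pattern there are fewer than `c` equalities; as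
`c` is regular, those that hold somewhere are witnessed below a common bound `δ`, and the witnesses
can be moved to any tuple of the same pattern in the sparse set. -/
theorem exists_isHomogeneous_comp {c : Cardinal.{u}} (hc : c.IsRegular) {U V : Type u}
    (hU : Cardinal.mk U < c) (F : U → c.ord.ToType → c.ord.ToType → V)
    (hF : ∀ σ : c.ord.ToType → c.ord.ToType, StrictMono σ → ∃ S : V → V,
      ∀ u i j, i < j → S (F u i j) = F u (σ i) (σ j)) :
    ∃ s : c.ord.ToType → c.ord.ToType, StrictMono s ∧
      ∀ (u v : U) (w τ : Fin 4 → c.ord.ToType), (∀ a b, w a < w b ↔ τ a < τ b) →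
        w 0 < w 1 → w 2 < w 3 → F u (w 0) (w 1) = F v (w 2) (w 3) →
        F u (s (τ 0)) (s (τ 1)) = F v (s (τ 2)) (s (τ 3)) := by
  -- An equality is coded by the two maps and by an order pattern of the four indices.
  let Good : U × U × (Fin 4 → Fin 4 → Prop) → (Fin 4 → c.ord.ToType) → Prop := fun t w =>
    (∀ a b, w a < w b ↔ t.2.2 a b) ∧ w 0 < w 1 ∧ w 2 < w 3 ∧
      F t.1 (w 0) (w 1) = F t.2.1 (w 2) (w 3)
  choose wit hwit using fun t : {t // ∃ w, Good t w} => t.2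
  have hfin : ∀ (T : Type u) [Finite T], Cardinal.mk T < c := fun T _ =>
    lt_of_lt_of_le (Cardinal.lt_aleph0_of_finite T) hc.aleph0_le
  have hcard : Cardinal.mk ({t // ∃ w, Good t w} × Fin 4) < c := by
    rw [Cardinal.mk_prod]
    refine Cardinal.mul_lt_of_lt hc.aleph0_le ?_ ?_
    · rw [Cardinal.lift_uzero]
      refine lt_of_le_of_lt (Cardinal.mk_subtype_le _) ?_
      simp only [Cardinal.mk_prod, Cardinal.lift_id, Cardinal.lift_uzero]
      refine Cardinal.mul_lt_of_lt hc.aleph0_le hU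
        (Cardinal.mul_lt_of_lt hc.aleph0_le hU ?_)
      simpa using hfin (ULift (Fin 4 → Fin 4 → Prop))
    · simpa using hfin (ULift (Fin 4))
  obtain ⟨δ, hδ⟩ := exists_bound hc hcard fun x => wit x.1 x.2
  obtain ⟨s, hs, hext⟩ := exists_sparse (ι := Fin 4) hc.aleph0_le δ
  refine ⟨s, hs, fun u v w τ hwτ h01 h23 h => ?_⟩
  let t : {t // ∃ w, Good t w} :=
    ⟨(u, v, fun a b => w a < w b), w, fun _ _ => Iff.rfl, h01, h23, h⟩
  obtain ⟨hpat, h01', h23', h'⟩ := hwit t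
  obtain ⟨σ, hσ, hσw⟩ := hext (wit t) τ (fun a => (hδ (t, a)).le)
    fun a b => (hpat a b).trans (hwτ a b)
  obtain ⟨S, hS⟩ := hF σ hσ
  rw [← hσw 0, ← hσw 1, ← hσw 2, ← hσw 3, ← hS _ _ _ h01', ← hS _ _ _ h23']
  exact congrArg S h'

theorem exists_double {c : Cardinal.{u}} (hc : Cardinal.aleph0 ≤ c) :
    ∃ θ θ' : c.ord.ToType → c.ord.ToType, IsDoubling θ θ' := by
  have hlim : Order.IsSuccLimit c.ord := Cardinal.isSuccLimit_ord hc
  have h1 : (1 : Ordinal.{u}) < c.ord := by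
    rw [← Cardinal.ord_one, Cardinal.ord_lt_ord]
    exact lt_of_lt_of_le Cardinal.one_lt_aleph0 hc
  obtain ⟨g, hg, -, hgap⟩ := Ordinal.exists_gaps hc h1
  let e : Set.Iio c.ord ≃o c.ord.ToType := Ordinal.ToType.mk
  have hs : ∀ i : c.ord.ToType, g (e.symm i).1 < c.ord := fun i => hg _ (e.symm i).2
  refine ⟨fun i => e ⟨g (e.symm i).1, hs i⟩,
    fun i => e ⟨g (e.symm i).1 + 1, by simpa using hlim.succ_lt (hs i)⟩, fun i => ?_,
    fun i j hij => ?_⟩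
  · exact e.lt_iff_lt.2 (lt_add_one (g (e.symm i).1))
  · exact e.lt_iff_lt.2 (hgap (e.symm i).1 (e.symm j).1 (e.symm.lt_iff_lt.2 hij))

theorem exists_bounded_injections {c : Cardinal.{u}} (hc : c.IsRegular) {W E : Type u}
    (hW : Cardinal.mk W < c) (hE : Cardinal.mk E < c) :
    ∃ (α : W → c.ord.ToType) (β : c.ord.ToType) (κ : E → c.ord.ToType),
      α.Injective ∧ κ.Injective ∧ (∀ x, α x < β) ∧ ∀ e, β < κ e := by
  have : NoMaxOrder c.ord.ToType := Cardinal.noMaxOrder hc.aleph0_le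
  have : Infinite c.ord.ToType := by
    rw [Cardinal.infinite_iff, Cardinal.mk_ord_toType]
    exact hc.aleph0_le
  obtain ⟨α⟩ : Nonempty (W ↪ c.ord.ToType) := by
    rw [← Cardinal.le_def, Cardinal.mk_ord_toType]
    exact hW.le
  obtain ⟨β, hβ⟩ := exists_bound hc hW α
  obtain ⟨β', hβ'⟩ := exists_gt β
  obtain ⟨κ⟩ : Nonempty (E ↪ ((Set.Iio β')ᶜ : Set c.ord.ToType)) := by
    rw [← Cardinal.le_def, Cardinal.mk_compl_of_infinite, Cardinal.mk_ord_toType]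
    · exact hE.le
    · exact Cardinal.mk_Iio_lt β' (by simp)
  exact ⟨α, β, fun e => (κ e).1, α.injective, Subtype.val_injective.comp κ.injective, hβ,
    fun e => lt_of_lt_of_le hβ' (not_lt.1 (κ e).2)⟩

/-! ### Homomorphisms and Gaifman graphs -/

variable {L : FirstOrder.Language.{u, u}}

theorem gaifmanGraph_adj_map {A M : Str L} (g : FirstOrder.Language.Hom L A.carrier M.carrier)
    {a b : A.carrier} (h : (gaifmanGraph A).Adj a b) (hne : g a ≠ g b) :
    (gaifmanGraph M).Adj (g a) (g b) := by
  obtain ⟨-, n, R, v, hv, ⟨i, rfl⟩, ⟨j, rfl⟩⟩ := h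
  exact ⟨hne, n, R, g ∘ v, g.map_rel R v hv, ⟨i, rfl⟩, ⟨j, rfl⟩⟩

/-- Let `p'` not be reachable from `p` in the Gaifman graph by steps that avoid the places where the
homomorphisms `g` and `g'` agree. Then `g'` on the part reachable from `p` and `g` elsewhere make up
a homomorphism: a tuple of a relation that meets this part lies inside it, up to places where `g`
and `g'` agree. -/
theorem exists_glued_hom [L.IsRelational] {A M : Str L}
    (g g' : FirstOrder.Language.Hom L A.carrier M.carrier) {p p' : A.carrier}
    (hp : ¬ Relation.ReflTransGen (fun a b => (gaifmanGraph A).Adj a b ∧ g b ≠ g' b) p p')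
    (hne : g p ≠ g' p) :
    ∃ h : FirstOrder.Language.Hom L A.carrier M.carrier, h p = g' p ∧ h p' = g p' := by
  classical
  let K : Set A.carrier :=
    {a | Relation.ReflTransGen (fun a b => (gaifmanGraph A).Adj a b ∧ g b ≠ g' b) p a}
  have hK : ∀ a ∈ K, g a ≠ g' a := fun a ha => by
    rcases Relation.ReflTransGen.cases_tail ha with rfl | ⟨b, -, -, h⟩
    · exact hne
    · exact h
  refine ⟨⟨fun a => if a ∈ K then g' a else g a, fun {n} F => isEmptyElim F, fun {n} R v hv => ?_⟩,
    if_pos Relation.ReflTransGen.refl, if_neg hp⟩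
  by_cases h : ∃ i, v i ∈ K
  · obtain ⟨i, hi⟩ := h
    convert g'.map_rel R v hv using 1
    funext j
    by_cases hj : v j ∈ K
    · exact if_pos hj
    · refine (if_neg hj).trans ?_
      by_contra hgj
      refine hj (Relation.ReflTransGen.tail hi ⟨⟨fun hij => hj (hij ▸ hi), n, R, v, hv, ⟨i, rfl⟩,
        ⟨j, rfl⟩⟩, hgj⟩)
  · convert g.map_rel R v hv using 1
    funext j
    exact if_neg fun hj => h ⟨j, hj⟩

/-- A path in `G'` whose vertices do not give functions determined by each entry separately becomes
a path of maps in `G` under `F`, once steps along which `F` does not change are left out. By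
homogeneity such a step leaves `F` unchanged for all pairs as soon as it does so for one. -/
theorem exists_isPathOfMaps_of_reflTransGen {J : Type*} [LinearOrder J] {U V : Type*}
    {F : U → J → J → V} (hF : IsHomogeneous F) {G : SimpleGraph V} {G' : SimpleGraph U}
    (hG : ∀ u v, G'.Adj u v → ∀ i j, i < j → F u i j ≠ F v i j → G.Adj (F u i j) (F v i j))
    {p p' : U} (hp : DependsOnLeft (F p)) (hp' : DependsOnRight (F p'))
    (hboth : ¬ (DependsOnLeft (F p) ∧ DependsOnRight (F p)))
    (h : Relation.ReflTransGen
      (fun u v => G'.Adj u v ∧ ¬ (DependsOnLeft (F v) ∧ DependsOnRight (F v))) p p') :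
    ∃ n q, IsPathOfMaps G F n q := by
  suffices H : ∃ (n : ℕ) (q : ℕ → U), q 0 = p ∧ (∀ i j, i < j → F (q n) i j = F p' i j) ∧
      (∀ t ≤ n, ¬ (DependsOnLeft (F (q t)) ∧ DependsOnRight (F (q t)))) ∧
      ∀ t < n, ∀ i j, i < j → G.Adj (F (q t) i j) (F (q (t + 1)) i j) by
    obtain ⟨n, q, h0, hn, hb, hadj⟩ := H
    exact ⟨n, q, h0 ▸ hp, hp'.congr fun i j hij => (hn i j hij).symm, hb, hadj⟩
  clear hp'
  induction h with
  | refl => exact ⟨0, fun _ => p, rfl, fun _ _ _ => rfl, fun _ _ => hboth,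
      fun t ht => absurd ht (Nat.not_lt_zero t)⟩
  | @tail b d _ hbd ih =>
    obtain ⟨n, q, h0, hn, hb, hadj⟩ := ih
    by_cases heq : ∃ i j, i < j ∧ F b i j = F d i j
    · obtain ⟨i, j, hij, heq⟩ := heq
      exact ⟨n, q, h0, fun i' j' h' => (hn i' j' h').trans (hF.eq hij h' heq), hb, hadj⟩
    · push Not at heq
      refine ⟨n + 1, fun t => if t ≤ n then q t else d, by simpa using h0, fun i j _ => by simp,
        fun t _ => ?_, fun t ht i j hij => ?_⟩
      · by_cases htn : t ≤ n
        · simpa only [htn, if_true] using hb t htn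
        · simpa only [htn, if_false] using hbd.2
      · by_cases htn : t < n
        · simpa only [htn.le, Nat.succ_le_of_lt htn, if_true] using hadj t htn i j hij
        · obtain rfl : t = n := by omega
          simpa [hn i j hij] using hG b d hbd.1 i j hij (heq i j hij)

/-! ### Subdivisions in the Gaifman graph -/

/-- Think of `B` and `M` as the images of the cardinals `2` and `c`, and of `X` as the carrier of
the image of `1`; `f i`, `F i j`, `e₀` and `e₁` come from the morphisms `1 ⟶ c`, `2 ⟶ c` and
`1 ⟶ 2`. The assumptions `hf` and `hfull` express faithfulness and fullness, and `hpush` is the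
action of the self-maps of `c`. -/
theorem exists_subdivision_isContained_gaifmanGraph [L.IsRelational] {c : Cardinal.{u}}
    (hc : c.IsRegular) {X : Type u} {B M : Str L} (hB : Cardinal.mk B.carrier < c)
    (f : c.ord.ToType → X → M.carrier)
    (F : c.ord.ToType → c.ord.ToType → FirstOrder.Language.Hom L B.carrier M.carrier)
    (e₀ e₁ : X → B.carrier) (he₀ : ∀ i j, i < j → ∀ x, F i j (e₀ x) = f i x)
    (he₁ : ∀ i j, i < j → ∀ x, F i j (e₁ x) = f j x)
    (hpush : ∀ σ : c.ord.ToType → c.ord.ToType, StrictMono σ → ∃ S : M.carrier → M.carrier,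
      ∀ u i j, i < j → S (F i j u) = F (σ i) (σ j) u)
    (hf : f.Injective)
    (hfull : ∀ h : FirstOrder.Language.Hom L B.carrier M.carrier,
      ∃ i j, i < j ∧ (∀ x, h (e₀ x) = f i x) ∧ ∀ x, h (e₁ x) = f j x) :
    ∃ r : ℕ, ∀ (W : Type u) (H : SimpleGraph W), Cardinal.mk W < c →
      (subdivision H r).IsContained (gaifmanGraph M) := by
  have : NoMaxOrder c.ord.ToType := Cardinal.noMaxOrder hc.aleph0_le
  have : Nonempty c.ord.ToType := by
    rw [← Cardinal.mk_ne_zero_iff, Cardinal.mk_ord_toType]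
    exact hc.pos.ne'
  obtain ⟨s, hs, hF⟩ := exists_isHomogeneous_comp hc hB (fun u i j => F i j u) hpush
  obtain ⟨i₀⟩ := this
  obtain ⟨i₁, h01⟩ := exists_gt i₀
  obtain ⟨i₂, h12⟩ := exists_gt i₁
  obtain ⟨i₃, h23⟩ := exists_gt i₂
  let Φ : B.carrier → c.ord.ToType → c.ord.ToType → M.carrier := fun u i j => F (s i) (s j) u
  have hΦ : IsHomogeneous Φ := fun u v w τ hwτ h h' heq =>
    hF u v (fun a => s (w a)) τ (fun a b => hs.lt_iff_lt.trans (hwτ a b)) (hs h) (hs h') heq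
  obtain ⟨x, hx⟩ : ∃ x, f (s i₀) x ≠ f (s i₁) x := by
    by_contra! h
    exact h01.ne (hs.injective (hf (funext h)))
  -- An equality that holds anywhere holds on the sparse set, so `x` separates all indices.
  have hlt : ∀ i j, i < j → f i x ≠ f j x := fun i j hij h => by
    obtain ⟨k, hk⟩ := exists_gt j
    refine hx ?_
    rw [← he₀ _ _ (hs (h01.trans h12)), ← he₀ _ _ (hs h12)]
    refine hF _ _ ![i, k, j, k] ![i₀, i₂, i₁, i₂] ?_ (hij.trans hk) hk
      ((he₀ _ _ (hij.trans hk) _).trans (h.trans (he₀ _ _ hk _).symm))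
    have h02 := h01.trans h12
    have hik := hij.trans hk
    intro a b
    fin_cases a <;> fin_cases b <;> simp [h01, h12, h02, hij, hk, hik, h01.not_gt, h12.not_gt,
      h02.not_gt, hij.not_gt, hk.not_gt, hik.not_gt]
  have hinj : ∀ i j, f i x = f j x → i = j := fun i j h => by
    rcases lt_trichotomy i j with h' | h' | h'
    · exact absurd h (hlt i j h')
    · exact h'
    · exact absurd h.symm (hlt j i h')
  have hleft : DependsOnLeft (Φ (e₀ x)) := fun i j k hij hik =>
    (he₀ _ _ (hs hij) x).trans (he₀ _ _ (hs hik) x).symm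
  have hright : DependsOnRight (Φ (e₁ x)) := fun i j k hik hjk =>
    (he₁ _ _ (hs hik) x).trans (he₁ _ _ (hs hjk) x).symm
  -- Otherwise a homomorphism could be glued that sends the first point of `2` above the second.
  have hconn : Relation.ReflTransGen (fun a b => (gaifmanGraph B).Adj a b ∧
      F (s i₀) (s i₁) b ≠ F (s i₂) (s i₃) b) (e₀ x) (e₁ x) := by
    by_contra hcon
    obtain ⟨h, h0, h1⟩ := exists_glued_hom _ _ hcon (by
      rw [he₀ _ _ (hs h01), he₀ _ _ (hs h23)]
      exact hlt _ _ (hs (h01.trans h12)))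
    obtain ⟨i, j, hij, hi, hj⟩ := hfull h
    rw [hi, he₀ _ _ (hs h23)] at h0
    rw [hj, he₁ _ _ (hs h01)] at h1
    rw [hinj _ _ h0, hinj _ _ h1] at hij
    exact lt_asymm hij (hs h12)
  have hboth : ∀ u, F (s i₀) (s i₁) u ≠ F (s i₂) (s i₃) u →
      ¬ (DependsOnLeft (Φ u) ∧ DependsOnRight (Φ u)) := fun u hu h =>
    hu ((h.1 _ _ _ h01 (h01.trans (h12.trans h23))).trans
      (h.2 _ _ _ (h01.trans (h12.trans h23)) h23))
  obtain ⟨n, q, hq⟩ := exists_isPathOfMaps_of_reflTransGen (G := gaifmanGraph M) hΦ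
    (fun u v huv i j _ hne => gaifmanGraph_adj_map (F (s i) (s j)) huv hne) hleft hright
    (hboth _ (by
      rw [he₀ _ _ (hs h01), he₀ _ _ (hs h23)]
      exact hlt _ _ (hs (h01.trans h12))))
    (Relation.ReflTransGen.mono (fun a b hab => ⟨hab.1, hboth b hab.2⟩) _ _ hconn)
  obtain ⟨n, q, hq⟩ := hq.exists_reduced hΦ
  obtain ⟨θ, θ', hθ⟩ := exists_double hc.aleph0_le
  refine ⟨2 * n - 1, fun W H hW => ?_⟩
  have hE : Cardinal.mk H.edgeSet < c := by
    refine lt_of_le_of_lt (Cardinal.mk_subtype_le _) (lt_of_le_of_lt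
      (Cardinal.mk_le_of_surjective (f := fun x : W × W => s(x.1, x.2)) fun e => ?_)
      (?_ : Cardinal.mk (W × W) < c))
    · induction e with | _ a b => exact ⟨(a, b), rfl⟩
    · rw [Cardinal.mk_prod, Cardinal.lift_id]
      exact Cardinal.mul_lt_of_lt hc.aleph0_le hW hW
  obtain ⟨α, β, κ, hα, hκ, hαβ, hβκ⟩ := exists_bounded_injections hc hW hE
  exact hq.subdivision_isContained hΦ hθ hα hκ hαβ hβκ

/-! ### The full embedding -/

theorem nonempty_finOrderIso (n : ℕ) : Nonempty (Fin n ≃o ((n : Cardinal.{u}).ord.ToType)) := by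
  have : Finite ((n : Cardinal.{u}).ord.ToType) := by
    rw [← Cardinal.lt_aleph0_iff_finite, Cardinal.mk_ord_toType]
    exact Cardinal.natCast_lt_aleph0
  cases nonempty_fintype ((n : Cardinal.{u}).ord.ToType)
  refine ⟨Fintype.orderIsoFinOfCardEq _ ?_⟩
  have h := Cardinal.mk_ord_toType (n : Cardinal.{u})
  rw [Cardinal.mk_fintype] at h
  exact_mod_cast h

namespace CardBelow

variable {κ : Cardinal.{u}} {a b : CardBelow κ}

/-- The function underlying a morphism of cardinals. -/
def toFun (f : a ⟶ b) : a.Elem → b.Elem :=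
  RelHom.toFun f

/-- The morphism of cardinals given by a strictly increasing function. -/
def ofStrictMono (f : a.Elem → b.Elem) (hf : StrictMono f) : a ⟶ b :=
  RelHom.mk (r := fun i j : a.Elem => i < j) (s := fun i j : b.Elem => i < j) f fun h => hf h

theorem toFun_strictMono (f : a ⟶ b) : StrictMono (toFun f) := fun _ _ h =>
  RelHom.map_rel' f h

theorem toFun_injective : (toFun : (a ⟶ b) → a.Elem → b.Elem).Injective := fun _ _ h =>
  RelHom.ext (congrFun h)

theorem toFun_ofStrictMono (f : a.Elem → b.Elem) (hf : StrictMono f) :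
    toFun (ofStrictMono f hf) = f :=
  rfl

end CardBelow

section Action

variable {κ : Cardinal.{u}} {L : FirstOrder.Language.{u, u}} {C : ObjectProperty (Str L)}
  (Ψ : CardBelow κ ⥤ (Str.below C κ).FullSubcategory) {a b c : CardBelow κ}

/-- The homomorphism of structures that a functor `Ψ` assigns to a morphism of cardinals. -/
def homOfMap (f : a ⟶ b) :
    FirstOrder.Language.Hom L (Ψ.obj a).obj.carrier (Ψ.obj b).obj.carrier :=
  (Ψ.map f).hom

theorem homOfMap_comp (f : a ⟶ b) (g : b ⟶ c) (u : (Ψ.obj a).obj.carrier) :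
    homOfMap Ψ (f ≫ g) u = homOfMap Ψ g (homOfMap Ψ f u) := by
  unfold homOfMap
  rw [Ψ.map_comp]
  rfl

theorem homOfMap_injective [Ψ.Faithful] {f g : a ⟶ b}
    (h : ∀ u, homOfMap Ψ f u = homOfMap Ψ g u) : f = g :=
  Ψ.map_injective (ObjectProperty.hom_ext _ (FirstOrder.Language.Hom.ext h))

theorem homOfMap_surjective [Ψ.Full]
    (h : FirstOrder.Language.Hom L (Ψ.obj a).obj.carrier (Ψ.obj b).obj.carrier) :
    ∃ f : a ⟶ b, homOfMap Ψ f = h := by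
  obtain ⟨f, hf⟩ := Ψ.map_surjective (ObjectProperty.homMk (X := Ψ.obj a) (Y := Ψ.obj b) h)
  exact ⟨f, congrArg (fun g => g.hom) hf⟩

end Action

/-- For every cardinal `c < κ`, the Gaifman graph of some structure in `C` contains all
`r`-subdivisions of graphs with at most `c` vertices, for some `r` that may depend on `c`. -/
theorem exists_subdivision_isContained_of_full_faithful {κ : Cardinal.{u}} (hκ : κ.IsInaccessible)
    {L : FirstOrder.Language.{u, u}} [L.IsRelational] {C : ObjectProperty (Str L)}
    (Ψ : CardBelow κ ⥤ (Str.below C κ).FullSubcategory) [Ψ.Full] [Ψ.Faithful]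
    {c : Cardinal.{u}} (hc : c < κ) :
    ∃ (M : Str L) (r : ℕ), C M ∧ ∀ (W : Type u) (H : SimpleGraph W), Cardinal.mk W ≤ c →
      (subdivision H r).IsContained (gaifmanGraph M) := by
  let one : CardBelow κ := ⟨(1 : ℕ), hκ.nat_lt 1⟩
  let two : CardBelow κ := ⟨(2 : ℕ), hκ.nat_lt 2⟩
  let B : Str L := (Ψ.obj two).obj
  have hB : Cardinal.mk B.carrier < κ := (Ψ.obj two).property.2
  -- `c` is replaced by a larger successor cardinal, which is regular and still below `κ`.
  let d : Cardinal.{u} := max (max c (Cardinal.mk B.carrier)) Cardinal.aleph0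
  have hd : Order.succ d < κ := hκ.isStrongLimit.isSuccLimit.succ_lt
    (max_lt (max_lt hc hB) hκ.aleph0_lt)
  have hreg : (Order.succ d).IsRegular := Cardinal.isRegular_succ (le_max_right _ _)
  let big : CardBelow κ := ⟨Order.succ d, hd⟩
  let M : Str L := (Ψ.obj big).obj
  obtain ⟨E₁⟩ : Nonempty (Fin 1 ≃o one.Elem) := nonempty_finOrderIso 1
  obtain ⟨E₂⟩ : Nonempty (Fin 2 ≃o two.Elem) := nonempty_finOrderIso 2
  have hsub : Subsingleton one.Elem := E₁.symm.injective.subsingleton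
  let pt : ∀ {b : CardBelow κ}, b.Elem → (one ⟶ b) := fun i =>
    CardBelow.ofStrictMono (fun _ => i) (Subsingleton.strictMono _)
  have hpt : ∀ {a b : CardBelow κ} (i : a.Elem) (g : a ⟶ b),
      pt i ≫ g = pt (CardBelow.toFun g i) := fun i g => rfl
  have hpt_inj : ∀ {b : CardBelow κ} {i j : b.Elem}, pt i = pt j → i = j := fun {b i j} h =>
    congrFun (congrArg CardBelow.toFun h) (E₁ 0)
  have hpair : ∀ i j : big.Elem, ∃ g : two ⟶ big, i < j →
      CardBelow.toFun g (E₂ 0) = i ∧ CardBelow.toFun g (E₂ 1) = j := by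
    intro i j
    have : NoMaxOrder big.Elem := Cardinal.noMaxOrder hreg.aleph0_le
    -- For `j ≤ i` the morphism is irrelevant; a larger `j'` takes the place of `j`.
    obtain ⟨j', hij', hj'⟩ : ∃ j', i < j' ∧ (i < j → j' = j) := by
      by_cases h : i < j
      · exact ⟨j, h, fun _ => rfl⟩
      · obtain ⟨j', hj'⟩ := exists_gt i
        exact ⟨j', hj', fun h' => absurd h' h⟩
    have hmono : StrictMono fun k : two.Elem => ![i, j'] (E₂.symm k) := by
      refine StrictMono.comp (g := ![i, j']) ?_ E₂.symm.strictMono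
      intro k l hkl
      fin_cases k <;> fin_cases l <;> simp_all
    refine ⟨CardBelow.ofStrictMono _ hmono, fun h => ?_⟩
    rw [CardBelow.toFun_ofStrictMono]
    simp [hj' h]
  choose pair hpair₀ using hpair
  have hpair : ∀ {i j : big.Elem} {g : two ⟶ big}, i < j → CardBelow.toFun g (E₂ 0) = i →
      CardBelow.toFun g (E₂ 1) = j → g = pair i j := by
    intro i j g hij h0 h1
    refine CardBelow.toFun_injective (funext fun k => ?_)
    obtain ⟨k, rfl⟩ := E₂.surjective k
    fin_cases k
    · exact h0.trans (hpair₀ i j hij).1.symm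
    · exact h1.trans (hpair₀ i j hij).2.symm
  obtain ⟨r, hr⟩ := exists_subdivision_isContained_gaifmanGraph hreg (B := B) (M := M)
    (lt_of_le_of_lt ((le_max_right _ _).trans (le_max_left _ _)) (Order.lt_succ d))
    (X := (Ψ.obj one).obj.carrier) (fun i => homOfMap Ψ (pt (b := big) i))
    (fun i j => homOfMap Ψ (pair i j)) (homOfMap Ψ (pt (E₂ 0))) (homOfMap Ψ (pt (E₂ 1)))
    (fun i j hij x => by rw [← homOfMap_comp, hpt, (hpair₀ i j hij).1])
    (fun i j hij x => by rw [← homOfMap_comp, hpt, (hpair₀ i j hij).2])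
    (fun σ hσ => ⟨homOfMap Ψ (CardBelow.ofStrictMono (a := big) (b := big) σ hσ),
      fun u i j hij => by
        rw [← homOfMap_comp, hpair (g := pair i j ≫ CardBelow.ofStrictMono σ hσ) (hσ hij)
          (congrArg σ (hpair₀ i j hij).1) (congrArg σ (hpair₀ i j hij).2)]⟩)
    (fun i j h => hpt_inj (homOfMap_injective Ψ (congrFun h)))
    (fun h => by
      obtain ⟨g, rfl⟩ := homOfMap_surjective Ψ h
      exact ⟨CardBelow.toFun g (E₂ 0), CardBelow.toFun g (E₂ 1),
        CardBelow.toFun_strictMono g (E₂.lt_iff_lt.2 Fin.zero_lt_one),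
        fun x => by rw [← homOfMap_comp, hpt], fun x => by rw [← homOfMap_comp, hpt]⟩)
  exact ⟨M, r, (Ψ.obj big).property.1, fun W H hW => hr W H
    (lt_of_le_of_lt (hW.trans ((le_max_left _ _).trans (le_max_left _ _))) (Order.lt_succ d))⟩

theorem mainTheorem2 (κ : Cardinal.{u}) (hκ : κ.IsInaccessible)
    (L : FirstOrder.Language.{u, u}) [L.IsRelational] (hL : L.card < κ)
    (C : ObjectProperty (Str L))
    (hΨ : ∃ Ψ : CardBelow κ ⥤ (Str.below C κ).FullSubcategory, Ψ.Full ∧ Ψ.Faithful) :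
    SomewhereDense (gaifmanClass C) κ := by
  obtain ⟨Ψ, _, _⟩ := hΨ
  intro hnd
  choose c hc hcG using hnd
  -- The supremum of the countably many bounds is below `κ`, so that it refutes whichever `r` the
  -- structure for this supremum comes with.
  have hsup : (⨆ r : ULift.{u} ℕ, c r.down) < κ :=
    Cardinal.iSup_lt_of_lt_cof_ord
      (by rw [hκ.isRegular.cof_ord]; simpa using hκ.aleph0_lt) fun r => hc r.down
  obtain ⟨M, r, hM, h⟩ := exists_subdivision_isContained_of_full_faithful hκ Ψ hsup
  refine hcG r _ ⟨M, hM, rfl⟩ (h _ _ ?_)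
  rw [Cardinal.mk_out]
  exact le_ciSup (f := fun r : ULift.{u} ℕ => c r.down) Cardinal.bddAbove_of_small ⟨r⟩
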